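/- Let $A_1,\dots,A_k$ be invertible real $2\times 2$ matrices with strictly positive entries, $A_i=\begin{pmatrix} a_i&b_i\\ c_i&d_i\end{pmatrix}$, and let $(p_1,\dots,p_k)$ be a probability vector. Let $D=\{z\in\mathbb{C}: |z-\tfrac12|<\tfrac12\}$ and let $H^2(D)$ be the Hardy–Hilbert space of functions $f(z)=\sum_{n\ge 0}\alpha_n(f)\,\bigl((z-\tfrac12)/\tfrac12\bigr)^n$ on $D$ with $\|f\|^2=\sum_{n\ge0}|\alpha_n(f)|^2<\infty$. For $z\in D$ put $$w_{A_i}(z)=(a_i+c_i-b_i-d_i)z+b_i+d_i,\qquad \varphi_{A_i}(z)=\frac{(a_i-b_i)z+b_i}{(a_i+c_i-b_i-d_i)z+b_i+d_i}\in D ,$$ and for $t\in\mathbb{C}$ let $$\mathcal{L}_t f=\sum_{i=1}^k p_i\, w_{A_i}^{\,t}\; f\circ\varphi_{A_i},$$ where $w^t=\exp(t\log w)$ with the principal logarithm. A bounded operator $L$ on a Hilbert space is trace-class if $\sum_{n\ge1}s_n(L)<\infty$, where $s_n(L)=\inf\{\|L-K\|:\operatorname{rank}K\le n-1\}$, and then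 $\operatorname{tr}(L)=\sum_n\langle Le_n,e_n\rangle$ for any orthonormal basis $(e_n)$. For a matrix $A$ with positive entries let $\lambda_1(A)>\lambda_2(A)$ be its two (real) eigenvalues, so that $\lambda_1(A)>|\lambda_2(A)|$. Then for every $t\in\mathbb{C}$, $\mathcal{L}_t$ is a bounded operator on $H^2(D)$, and for every integer $m\ge 1$ the operator $\mathcal{L}_t^m$ is trace-class and $$\operatorname{tr}(\mathcal{L}_t^m)=\sum_{(i_1,\dots,i_m)\in\{1,\dots,k\}^m} p_{i_1}\cdots p_{i_m}\;\lambda_1(A)^t\left(1-\frac{\lambda_2(A)}{\lambda_1(A)}\right)^{-1},\qquad A=A_{i_1}\cdots A_{i_m}.$$ -/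

import Mathlib

open scoped InnerProductSpace

/-! ### The disc and its Hardy-Hilbert space -/

/-- The open disc `D` of radius `1/2` centred at `1/2`. -/
def hardyDisc : Set ℂ := Metric.ball (1 / 2) (1 / 2)

theorem mem_hardyDisc_iff (z : ℂ) : z ∈ hardyDisc ↔ Complex.normSq z < z.re := by
  have h : ‖z - 1 / 2‖ ^ 2 = Complex.normSq z - z.re + (1 / 2) ^ 2 := by
    rw [← Complex.normSq_eq_norm_sq, Complex.normSq_apply, Complex.normSq_apply]
    simp
    ring
  rw [hardyDisc, Metric.mem_ball, Complex.dist_eq, ← sq_lt_sq₀ (norm_nonneg _) (by norm_num), h]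
  constructor <;> intro h' <;> linarith

/-- Membership in the Hardy-Hilbert space `H²(D)`: the functions on `D` that have an expansion
`f(z) = ∑ₙ αₙ (z - c)ⁿ / ρⁿ` (`c = ρ = 1/2`) with square-summable coefficients `αₙ`
(such an `f` is holomorphic on `D`). The operations are the pointwise ones. -/
def hardySubmodule : Submodule ℂ (hardyDisc → ℂ) where
  carrier := {f | ∃ α : lp (fun _ : ℕ => ℂ) 2,
    ∀ z : hardyDisc, HasSum (fun n : ℕ => α n * (((z : ℂ) - 1 / 2) / (1 / 2)) ^ n) (f z)}
  add_mem' := by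
    rintro f g ⟨α, hα⟩ ⟨β, hβ⟩
    refine ⟨α + β, fun z => ?_⟩
    simpa [add_mul] using (hα z).add (hβ z)
  zero_mem' := ⟨0, fun z => by simp⟩
  smul_mem' := by
    rintro c f ⟨α, hα⟩
    refine ⟨c • α, fun z => ?_⟩
    simpa [mul_assoc] using (hα z).mul_left c

/-- The Hardy-Hilbert space `H²(D)`, as a type. (It does not inherit the topology of pointwise
convergence from `hardyDisc → ℂ`: its norm is defined below.) -/
def HardySpace : Type := hardySubmodule

namespace HardySpace

instance : AddCommGroup HardySpace := inferInstanceAs (AddCommGroup hardySubmodule)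

instance : Module ℂ HardySpace := inferInstanceAs (Module ℂ hardySubmodule)

instance : CoeFun HardySpace (fun _ => hardyDisc → ℂ) := ⟨fun f => f.1⟩

theorem ext_fun {f g : HardySpace} (h : ∀ z, f z = g z) : f = g := Subtype.ext (funext h)

theorem coeff_unique {α β : ℕ → ℂ} {f : hardyDisc → ℂ}
    (hα : ∀ z : hardyDisc, HasSum (fun n : ℕ => α n * (((z : ℂ) - 1 / 2) / (1 / 2)) ^ n) (f z))
    (hβ : ∀ z : hardyDisc, HasSum (fun n : ℕ => β n * (((z : ℂ) - 1 / 2) / (1 / 2)) ^ n) (f z)) :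
    α = β := by
  have key : ∀ u : ℂ, ‖u‖ < 1 → HasSum (fun n : ℕ => (α n - β n) * u ^ n) 0 := by
    intro u hu
    have hz : 1 / 2 + u / 2 ∈ hardyDisc := by
      rw [hardyDisc, Metric.mem_ball, Complex.dist_eq]
      simp
      linarith
    have e : (1 / 2 + u / 2 - 1 / 2) / (1 / 2) = u := by ring
    have h := (hα ⟨_, hz⟩).sub (hβ ⟨_, hz⟩)
    simp only [e, sub_self, ← sub_mul] at h
    exact h
  let q : FormalMultilinearSeries ℂ ℂ ℂ :=
    fun n => ContinuousMultilinearMap.mkPiRing ℂ (Fin n) (α n - β n)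
  have hq : HasFPowerSeriesAt (fun _ : ℂ => (0 : ℂ)) q 0 := by
    rw [hasFPowerSeriesAt_iff]
    filter_upwards [Metric.ball_mem_nhds (0 : ℂ) one_pos] with u hu
    have := key u (by simpa using hu)
    simpa [q, FormalMultilinearSeries.coeff, mul_comm] using this
  have h0 := hq.eq_zero
  funext n
  have h1 : q.coeff n = 0 := by rw [h0]; simp [FormalMultilinearSeries.coeff]
  have h2 : q.coeff n = α n - β n := by simp [q, FormalMultilinearSeries.coeff]
  exact sub_eq_zero.mp (h2 ▸ h1)

/-- The sequence of normalized Taylor coefficients `αₙ(f)`, as an element of `ℓ²`. -/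
noncomputable def coeffs (f : HardySpace) : lp (fun _ : ℕ => ℂ) 2 := f.2.choose

theorem hasSum_coeffs (f : HardySpace) (z : hardyDisc) :
    HasSum (fun n : ℕ => f.coeffs n * (((z : ℂ) - 1 / 2) / (1 / 2)) ^ n) (f z) :=
  f.2.choose_spec z

theorem coeffs_eq {f : HardySpace} {α : lp (fun _ : ℕ => ℂ) 2}
    (h : ∀ z : hardyDisc, HasSum (fun n : ℕ => α n * (((z : ℂ) - 1 / 2) / (1 / 2)) ^ n) (f z)) :
    f.coeffs = α :=
  lp.ext (coeff_unique (hasSum_coeffs f) h)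

/-- `f ↦ (αₙ(f))ₙ` is a linear bijection of `H²(D)` onto `ℓ²`. -/
noncomputable def coeffsEquiv : HardySpace ≃ₗ[ℂ] lp (fun _ : ℕ => ℂ) 2 :=
  LinearEquiv.ofBijective
    { toFun := coeffs
      map_add' := fun f g => coeffs_eq fun z => by
        have h : (f + g) z = f z + g z := rfl
        rw [h]
        simpa [add_mul] using (hasSum_coeffs f z).add (hasSum_coeffs g z)
      map_smul' := fun c f => coeffs_eq fun z => by
        have h : (c • f) z = c * f z := rfl
        rw [h]
        simpa [mul_assoc] using (hasSum_coeffs f z).mul_left c }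
    (by
      constructor
      · intro f g hfg
        have hfg' : f.coeffs = g.coeffs := hfg
        refine ext_fun fun z => (hasSum_coeffs f z).unique ?_
        rw [hfg']
        exact hasSum_coeffs g z
      · intro α
        have hs : ∀ z : hardyDisc,
            Summable (fun n : ℕ => α n * (((z : ℂ) - 1 / 2) / (1 / 2)) ^ n) := by
          intro z
          have hz : ‖((z : ℂ) - 1 / 2) / (1 / 2)‖ < 1 := by
            have : ‖(z : ℂ) - 1 / 2‖ < 1 / 2 := mem_ball_iff_norm.mp z.2
            rw [norm_div, div_lt_one (by norm_num)]
            simpa using this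
          refine Summable.of_norm_bounded
            ((summable_geometric_of_lt_one (norm_nonneg _) hz).mul_left ‖α‖) fun n => ?_
          rw [norm_mul, norm_pow]
          gcongr
          exact lp.norm_apply_le_norm (by norm_num) α n
        let f : HardySpace := ⟨fun z => ∑' n : ℕ, α n * (((z : ℂ) - 1 / 2) / (1 / 2)) ^ n,
          α, fun z => (hs z).hasSum⟩
        exact ⟨f, coeffs_eq (f := f) fun z => (hs z).hasSum⟩)

/-- The norm of `H²(D)`: `‖f‖ = (∑ₙ |αₙ(f)|²)^(1/2)`. -/
noncomputable instance : NormedAddCommGroup HardySpace :=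
  NormedAddCommGroup.induced HardySpace (lp (fun _ : ℕ => ℂ) 2) coeffsEquiv coeffsEquiv.injective

theorem norm_def (f : HardySpace) : ‖f‖ = ‖f.coeffs‖ := rfl

/-- The inner product of `H²(D)`: that of the coefficient sequences in `ℓ²`
(conjugate-linear in the first variable, as always in Mathlib). -/
noncomputable instance : InnerProductSpace ℂ HardySpace where
  norm_smul_le c f := by
    have h : ‖coeffsEquiv (c • f)‖ ≤ ‖c‖ * ‖coeffsEquiv f‖ := by
      rw [map_smul, norm_smul]
    exact h
  inner f g := ⟪coeffsEquiv f, coeffsEquiv g⟫_ℂ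
  norm_sq_eq_re_inner f := norm_sq_eq_re_inner (𝕜 := ℂ) (coeffsEquiv f)
  conj_inner_symm f g := inner_conj_symm (coeffsEquiv f) (coeffsEquiv g)
  add_left f g h := by rw [map_add, inner_add_left]
  smul_left f g c := by rw [map_smul, inner_smul_left]

instance : CompleteSpace HardySpace := by
  let e : HardySpace ≃ₗᵢ[ℂ] lp (fun _ : ℕ => ℂ) 2 := ⟨coeffsEquiv, fun _ => rfl⟩
  exact e.toIsometryEquiv.completeSpace

end HardySpace

/-! ### Trace-class operators -/

/-- `approximationNumber L n` is the `(n+1)`-st approximation number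
`s_{n+1}(L) = inf {‖L - K‖ : rank K ≤ n}` of a bounded operator `L`. -/
noncomputable def approximationNumber {H : Type*} [NormedAddCommGroup H] [InnerProductSpace ℂ H]
    (L : H →L[ℂ] H) (n : ℕ) : ℝ :=
  sInf {s : ℝ | ∃ K : H →L[ℂ] H, (K : H →ₗ[ℂ] H).rank ≤ (n : Cardinal) ∧ s = ‖L - K‖}

/-- `L` is trace-class: its approximation numbers are summable. -/
def IsTraceClass {H : Type*} [NormedAddCommGroup H] [InnerProductSpace ℂ H]
    (L : H →L[ℂ] H) : Prop :=
  Summable (approximationNumber L)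

/-- `τ` is the trace of `L`: for every orthonormal basis `(eᵢ)` of `H`, the series
`∑ᵢ ⟨L eᵢ, eᵢ⟩` (linear in the entry `L eᵢ`) converges to `τ`. -/
def HasTrace.{u} {H : Type u} [NormedAddCommGroup H] [InnerProductSpace ℂ H]
    (L : H →L[ℂ] H) (τ : ℂ) : Prop :=
  ∀ (ι : Type u) (e : HilbertBasis ι ℂ H), HasSum (fun i => ⟪e i, L (e i)⟫_ℂ) τ

/-! ### Positive matrices and the transfer operator -/

/-- All entries are (strictly) positive. -/
def IsPositiveMatrix (A : Matrix (Fin 2) (Fin 2) ℝ) : Prop := ∀ i j, 0 < A i j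

/-- The weight `w_A(z) = (a + c - b - d) z + b + d` for `A = (a b; c d)`. -/
noncomputable def weight (A : Matrix (Fin 2) (Fin 2) ℝ) (z : ℂ) : ℂ :=
  (A 0 0 + A 1 0 - A 0 1 - A 1 1) * z + A 0 1 + A 1 1

/-- The projective action `φ_A(z) = ((a - b) z + b) / ((a + c - b - d) z + b + d)`. -/
noncomputable def projMap (A : Matrix (Fin 2) (Fin 2) ℝ) (z : ℂ) : ℂ :=
  ((A 0 0 - A 0 1) * z + A 0 1) / ((A 0 0 + A 1 0 - A 0 1 - A 1 1) * z + A 0 1 + A 1 1)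

theorem projMap_mem {A : Matrix (Fin 2) (Fin 2) ℝ} (hA : IsPositiveMatrix A) {z : ℂ}
    (hz : z ∈ hardyDisc) : projMap A z ∈ hardyDisc := by
  have ha := hA 0 0
  have hb := hA 0 1
  have hc := hA 1 0
  have hd := hA 1 1
  rw [mem_hardyDisc_iff] at hz ⊢
  rw [projMap]
  generalize A 0 0 = a at *
  generalize A 0 1 = b at *
  generalize A 1 0 = c at *
  generalize A 1 1 = d at *
  obtain ⟨x, y⟩ := z
  rw [Complex.normSq_mk] at hz
  simp only at hz
  have hx : 0 < x := by nlinarith [mul_self_nonneg x, mul_self_nonneg y]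
  have hx1 : x < 1 := by nlinarith [mul_self_nonneg y]
  have hre : 0 < (a + c) * x + (b + d) * (1 - x) := by
    have : 0 < 1 - x := by linarith
    positivity
  have hw : 0 < Complex.normSq (((a : ℂ) + c - b - d) * ⟨x, y⟩ + b + d) := by
    rw [Complex.normSq_pos]
    intro h
    have := congrArg Complex.re h
    simp at this
    nlinarith
  rw [map_div₀, Complex.div_re, ← add_div]
  refine (div_lt_div_iff_of_pos_right hw).mpr ?_
  simp [Complex.normSq_apply]
  have e1 : 0 < (a * c) * (x * x + y * y) := by
    have : 0 < x * x + y * y := by nlinarith [mul_self_nonneg y, mul_pos hx hx]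
    positivity
  have e2 : 0 ≤ (b * d) * ((1 - x) * (1 - x) + y * y) := by
    have : 0 ≤ (1 - x) * (1 - x) + y * y := by
      nlinarith [mul_self_nonneg y, mul_self_nonneg (1 - x)]
    positivity
  have e3 : 0 < (a * d + b * c) * (x - (x * x + y * y)) := by
    have : 0 < x - (x * x + y * y) := by linarith
    positivity
  linarith

/-- The transfer operator `(𝓛_t f)(z) = ∑ᵢ pᵢ w_{Aᵢ}(z)^t f(φ_{Aᵢ}(z))`, on arbitrary functions
`f : D → ℂ`. The power is `exp (t log w)` with the principal logarithm, the holomorphic one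
on the right half-plane with `log 1 = 0`. -/
noncomputable def transferFun {k : ℕ} (A : Fin k → Matrix (Fin 2) (Fin 2) ℝ)
    (hA : ∀ i, IsPositiveMatrix (A i)) (p : Fin k → ℝ) (t : ℂ) (f : hardyDisc → ℂ) :
    hardyDisc → ℂ :=
  fun z => ∑ i, (p i : ℂ) * weight (A i) z ^ t * f ⟨projMap (A i) z, projMap_mem (hA i) z.2⟩

/-! ### Products and eigenvalues -/

/-- The product `A_{i₁} ⋯ A_{iₘ}` of the word `i = (i₁, …, iₘ)`. -/
def wordProd {k m : ℕ} (A : Fin k → Matrix (Fin 2) (Fin 2) ℝ) (i : Fin m → Fin k) :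
    Matrix (Fin 2) (Fin 2) ℝ :=
  (List.ofFn fun j => A (i j)).prod

/-- The largest real eigenvalue `λ₁(B)`. -/
noncomputable def lamOne (B : Matrix (Fin 2) (Fin 2) ℝ) : ℝ := sSup (spectrum ℝ B)

/-- The smallest real eigenvalue `λ₂(B)`. For positive `B` the two eigenvalues are real and
distinct, see `spectrum_of_isPositiveMatrix`. -/
noncomputable def lamTwo (B : Matrix (Fin 2) (Fin 2) ℝ) : ℝ := sInf (spectrum ℝ B)

/-- A positive `2 × 2` matrix has exactly the eigenvalues `λ₁` and `λ₂`, and `|λ₂| < λ₁`, so `λ₁` is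
the Perron-Frobenius eigenvalue. -/
theorem spectrum_of_isPositiveMatrix {B : Matrix (Fin 2) (Fin 2) ℝ} (hB : IsPositiveMatrix B) :
    spectrum ℝ B = {lamOne B, lamTwo B} ∧ |lamTwo B| < lamOne B := by
  have ha := hB 0 0
  have hb := hB 0 1
  have hc := hB 1 0
  have hd := hB 1 1
  set Δ : ℝ := (B 0 0 - B 1 1) ^ 2 + 4 * (B 0 1 * B 1 0) with hΔ
  have hΔ0 : 0 < Δ := by positivity
  set s := √Δ with hs
  have hs0 : 0 < s := Real.sqrt_pos.mpr hΔ0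
  have hss : s * s = Δ := Real.mul_self_sqrt hΔ0.le
  set u := (B 0 0 + B 1 1 + s) / 2 with hu
  set v := (B 0 0 + B 1 1 - s) / 2 with hv
  have hvu : v ≤ u := by rw [hu, hv]; linarith
  have key : spectrum ℝ B = {u, v} := by
    ext x
    have hx : (algebraMap ℝ (Matrix (Fin 2) (Fin 2) ℝ) x - B).det = (x - u) * (x - v) := by
      rw [Matrix.det_fin_two]
      simp [Matrix.algebraMap_matrix_apply]
      rw [hu, hv]
      nlinarith
    rw [spectrum.mem_iff, Matrix.isUnit_iff_isUnit_det, hx, isUnit_iff_ne_zero, not_not,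
      mul_eq_zero, sub_eq_zero, sub_eq_zero]
    rfl
  have h1 : lamOne B = u := by
    rw [lamOne, key, csSup_pair]
    exact max_eq_left hvu
  have h2 : lamTwo B = v := by
    rw [lamTwo, key, csInf_pair]
    exact min_eq_right hvu
  rw [h1, h2]
  refine ⟨key, abs_lt.mpr ⟨?_, ?_⟩⟩ <;> rw [hu, hv] <;> linarith

/-! For a positive matrix `B` let `C_B f = w_B ^ t * f ∘ φ_B`. Since `w_B(z)` is the sum of the
entries of `B (z, 1 - z)ᵀ` and `φ_B(z)` is its normalized first entry, `C_B C_A = C_{AB}`. Hence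
powers of `𝓛_t` expand over words, and everything reduces to one operator `C_B`.

Positivity makes `φ_B` map the closed disc into the open one, so by compactness a disc of radius `R
> 1/2` is mapped into a disc of radius `r / 2` with `r < 1`. The monomials `eₙ` then satisfy `‖C_B
eₙ‖ ≤ const * r ^ n`. This decay gives trace class by truncation (`HasGeometricDecay.isTraceClass`)
and independence of the trace from the basis by an absolutely summable double series
(`HasGeometricDecay.hasTrace`).

By Cauchy's formula on `|z - 1/2| = R`, the diagonal entries of `C_B` form a geometric series under
the integral, with sum `(2πi)⁻¹ ∮ w_B ^ t / (z - φ_B(z)) dz`. Here `z - φ_B(z) = (z - z₀) (w_B(z) -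
λ₂) / w_B(z)` (`sub_projMap`), and `Re w_B > λ₂` on the disc, so the attracting fixed point `z₀` is
the only pole. As `w_B(z₀) = λ₁`, the residue is `λ₁ ^ t (1 - λ₂/λ₁)⁻¹`. -/

/-! ### Operators with geometrically decaying columns -/

section GeometricDecay

variable {H : Type*} [NormedAddCommGroup H] [InnerProductSpace ℂ H]

/-- The images of the vectors of the basis `e` under `L` decay geometrically. -/
def HasGeometricDecay (e : HilbertBasis ℕ ℂ H) (L : H →L[ℂ] H) : Prop :=
  ∃ M r : ℝ, 0 ≤ r ∧ r < 1 ∧ ∀ n, ‖L (e n)‖ ≤ M * r ^ n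

namespace HasGeometricDecay

variable {e : HilbertBasis ℕ ℂ H} {L L' : H →L[ℂ] H}

theorem zero : HasGeometricDecay e (0 : H →L[ℂ] H) :=
  ⟨0, 0, le_rfl, one_pos, fun n => by simp⟩

theorem add (hL : HasGeometricDecay e L) (hL' : HasGeometricDecay e L') :
    HasGeometricDecay e (L + L') := by
  obtain ⟨M, r, hr0, hr1, h⟩ := hL
  obtain ⟨M', r', hr0', hr1', h'⟩ := hL'
  have hM : 0 ≤ M := by simpa using (norm_nonneg _).trans (h 0)
  have hM' : 0 ≤ M' := by simpa using (norm_nonneg _).trans (h' 0)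
  refine ⟨M + M', max r r', le_max_of_le_left hr0, max_lt hr1 hr1', fun n => ?_⟩
  calc ‖(L + L') (e n)‖ ≤ ‖L (e n)‖ + ‖L' (e n)‖ := norm_add_le _ _
    _ ≤ M * r ^ n + M' * r' ^ n := add_le_add (h n) (h' n)
    _ ≤ M * max r r' ^ n + M' * max r r' ^ n := by
        gcongr
        · exact le_max_left _ _
        · exact le_max_right _ _
    _ = (M + M') * max r r' ^ n := by ring

theorem smul (c : ℂ) (hL : HasGeometricDecay e L) : HasGeometricDecay e (c • L) := by
  obtain ⟨M, r, hr0, hr1, h⟩ := hL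
  refine ⟨‖c‖ * M, r, hr0, hr1, fun n => ?_⟩
  rw [smul_apply, norm_smul, mul_assoc]
  exact mul_le_mul_of_nonneg_left (h n) (norm_nonneg c)

theorem sum {ι : Type*} (s : Finset ι) {F : ι → H →L[ℂ] H}
    (hF : ∀ i ∈ s, HasGeometricDecay e (F i)) : HasGeometricDecay e (∑ i ∈ s, F i) :=
  Finset.sum_induction F (HasGeometricDecay e) (fun _ _ h h' => h.add h') zero hF

/-- Truncation after `n` basis vectors bounds the `(n+1)`-st approximation number. -/
theorem isTraceClass (hL : HasGeometricDecay e L) : IsTraceClass L := by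
  obtain ⟨M, r, hr0, hr1, h⟩ := hL
  have hM : 0 ≤ M := by simpa using (norm_nonneg _).trans (h 0)
  have hbdd : ∀ n : ℕ, ∀ s ∈ {s : ℝ | ∃ K : H →L[ℂ] H,
      (K : H →ₗ[ℂ] H).rank ≤ (n : Cardinal) ∧ s = ‖L - K‖}, 0 ≤ s := by
    rintro n s ⟨K, -, rfl⟩
    exact norm_nonneg _
  -- The constant is the geometric tail `∑ⱼ M r ^ (j + n)`, which bounds the columns that truncation
  -- discards.
  refine Summable.of_nonneg_of_le (f := fun n => M * (1 - r)⁻¹ * r ^ n)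
    (fun n => Real.sInf_nonneg (hbdd n)) (fun n => ?_)
    ((summable_geometric_of_lt_one hr0 hr1).mul_left _)
  set K : H →L[ℂ] H := ∑ j ∈ Finset.range n, InnerProductSpace.rankOne ℂ (L (e j)) (e j) with hK
  have hKapp : ∀ f, K f = ∑ j ∈ Finset.range n, ⟪e j, f⟫_ℂ • L (e j) := fun f => by
    simp [hK]
  have hrank : (K : H →ₗ[ℂ] H).rank ≤ (n : Cardinal) := by
    classical
    have hle : LinearMap.range (K : H →ₗ[ℂ] H) ≤
        Submodule.span ℂ (((Finset.range n).image fun j => L (e j) : Finset H) : Set H) := by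
      rintro _ ⟨f, rfl⟩
      rw [ContinuousLinearMap.coe_coe, hKapp]
      refine Submodule.sum_mem _ fun j hj => Submodule.smul_mem _ _ (Submodule.subset_span ?_)
      exact Finset.mem_coe.mpr (Finset.mem_image_of_mem _ hj)
    refine (Submodule.rank_mono hle).trans ((rank_span_finset_le _).trans ?_)
    exact_mod_cast Finset.card_image_le.trans (Finset.card_range n).le
  refine (csInf_le ⟨0, hbdd n⟩ ⟨K, hrank, rfl⟩).trans ?_
  refine ContinuousLinearMap.opNorm_le_bound _
    (mul_nonneg (mul_nonneg hM (inv_nonneg.mpr (sub_nonneg.mpr hr1.le))) (pow_nonneg hr0 n))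
    fun f => ?_
  have hs : HasSum (fun j => ⟪e j, f⟫_ℂ • L (e j)) (L f) := by
    simpa [Function.comp_def, HilbertBasis.repr_apply_apply] using L.hasSum (e.hasSum_repr f)
  have htail : HasSum (fun j => ⟪e (j + n), f⟫_ℂ • L (e (j + n))) ((L - K) f) := by
    have := (hasSum_nat_add_iff' n).mpr hs
    rwa [← hKapp] at this
  rw [← htail.tsum_eq]
  refine (tsum_of_norm_bounded
    (((hasSum_geometric_of_lt_one hr0 hr1).mul_left (‖f‖ * M * r ^ n))) fun j => ?_).trans
    (le_of_eq (by ring))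
  rw [norm_smul]
  calc ‖⟪e (j + n), f⟫_ℂ‖ * ‖L (e (j + n))‖ ≤ ‖f‖ * (M * r ^ (j + n)) := by
        gcongr
        · simpa [e.orthonormal.norm_eq_one] using norm_inner_le_norm (𝕜 := ℂ) (e (j + n)) f
        · exact h _
    _ = ‖f‖ * M * r ^ n * r ^ j := by ring

end HasGeometricDecay

/-- Cauchy–Schwarz followed by Bessel. Uniformity in `s` gives absolute summability of the rows of
the double series behind the trace. -/
theorem HilbertBasis.sum_norm_inner_mul_inner_le {ι : Type*} (b : HilbertBasis ι ℂ H) (x y : H)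
    (s : Finset ι) : ∑ i ∈ s, ‖⟪x, b i⟫_ℂ * ⟪b i, y⟫_ℂ‖ ≤ ‖x‖ * ‖y‖ := by
  have hx := b.orthonormal.sum_inner_products_le x (s := s)
  have hy := b.orthonormal.sum_inner_products_le y (s := s)
  simp only [norm_mul]
  refine abs_le_of_sq_le_sq' ?_ (by positivity) |>.2
  calc (∑ i ∈ s, ‖⟪x, b i⟫_ℂ‖ * ‖⟪b i, y⟫_ℂ‖) ^ 2
      ≤ (∑ i ∈ s, ‖⟪x, b i⟫_ℂ‖ ^ 2) * ∑ i ∈ s, ‖⟪b i, y⟫_ℂ‖ ^ 2 :=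
        Finset.sum_mul_sq_le_sq_mul_sq _ _ _
    _ ≤ ‖x‖ ^ 2 * ‖y‖ ^ 2 := by
        gcongr
        simpa only [norm_inner_symm] using hx
    _ = (‖x‖ * ‖y‖) ^ 2 := by ring

/-- The diagonal sum over the basis `e` is the trace in every orthonormal basis. -/
theorem HasGeometricDecay.hasTrace.{u} {H : Type u} [NormedAddCommGroup H]
    [InnerProductSpace ℂ H] {e : HilbertBasis ℕ ℂ H} {L : H →L[ℂ] H}
    (hL : HasGeometricDecay e L) {τ : ℂ} (hτ : HasSum (fun n => ⟪e n, L (e n)⟫_ℂ) τ) :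
    HasTrace L τ := by
  intro ι b
  obtain ⟨M, r, hr0, hr1, h⟩ := hL
  -- Summing over `ι` first gives the diagonal of `L` in `e`, summing over `ℕ` first gives its
  -- diagonal in `b`. Absolute summability allows the interchange.
  let F : ℕ × ι → ℂ := fun q => ⟪e q.1, b q.2⟫_ℂ * ⟪b q.2, L (e q.1)⟫_ℂ
  have hrow : ∀ n, ∀ s : Finset ι, ∑ i ∈ s, ‖F (n, i)‖ ≤ M * r ^ n := fun n s => by
    refine (b.sum_norm_inner_mul_inner_le (e n) (L (e n)) s).trans ?_
    rw [e.orthonormal.norm_eq_one, one_mul]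
    exact h n
  have hF : Summable F := by
    refine Summable.of_norm ((summable_prod_of_nonneg fun _ => norm_nonneg _).mpr
      ⟨fun n => summable_of_sum_le (fun _ => norm_nonneg _) (hrow n), ?_⟩)
    exact Summable.of_nonneg_of_le (fun n => tsum_nonneg fun _ => norm_nonneg _)
      (fun n => Real.tsum_le_of_sum_le (fun _ => norm_nonneg _) (hrow n))
      ((summable_geometric_of_lt_one hr0 hr1).mul_left M)
  have h1 : HasSum (fun n => ⟪e n, L (e n)⟫_ℂ) (∑' q, F q) :=
    hF.hasSum.prod_fiberwise fun n => b.hasSum_inner_mul_inner (e n) (L (e n))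
  rw [hτ.unique h1]
  refine HasSum.prod_fiberwise ((Equiv.prodComm ι ℕ).hasSum_iff.mpr hF.hasSum) fun i => ?_
  have hs : HasSum (fun n => ⟪e n, b i⟫_ℂ • L (e n)) (L (b i)) := by
    simpa [Function.comp_def, HilbertBasis.repr_apply_apply] using L.hasSum (e.hasSum_repr (b i))
  simpa [F, Function.comp_def, inner_smul_right] using (innerSL ℂ (b i)).hasSum hs

theorem HasTrace.sum_smul {ι : Type*} (s : Finset ι) {F : ι → H →L[ℂ] H} {c τ : ι → ℂ}
    (h : ∀ i ∈ s, HasTrace (F i) (τ i)) :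
    HasTrace (∑ i ∈ s, c i • F i) (∑ i ∈ s, c i * τ i) := by
  intro κ b
  have := hasSum_sum fun i hi => (h i hi κ b).mul_left (c i)
  simpa [sum_apply, inner_sum, inner_smul_right] using this

end GeometricDecay

/-! ### Monomials and point evaluations in the Hardy space -/

namespace HardySpace

/-- The orthonormal basis of the normalized monomials `((z - 1/2) / (1/2)) ^ n`. -/
noncomputable def monomialBasis : HilbertBasis ℕ ℂ HardySpace :=
  HilbertBasis.ofRepr ⟨coeffsEquiv, fun _ => rfl⟩

theorem inner_monomialBasis (n : ℕ) (f : HardySpace) : ⟪monomialBasis n, f⟫_ℂ = f.coeffs n := by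
  rw [← HilbertBasis.repr_apply_apply]
  rfl

theorem coeffs_monomialBasis (n : ℕ) : (monomialBasis n).coeffs = lp.single 2 n 1 :=
  monomialBasis.repr_self n

theorem norm_coord_lt_one (z : hardyDisc) : ‖((z : ℂ) - 1 / 2) / (1 / 2)‖ < 1 := by
  have : ‖(z : ℂ) - 1 / 2‖ < 1 / 2 := mem_ball_iff_norm.mp z.2
  rw [norm_div, div_lt_one (by norm_num)]
  simpa using this

theorem monomialBasis_apply (n : ℕ) (z : hardyDisc) :
    monomialBasis n z = (((z : ℂ) - 1 / 2) / (1 / 2)) ^ n := by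
  refine (hasSum_coeffs (monomialBasis n) z).unique ?_
  rw [coeffs_monomialBasis]
  simpa using hasSum_single (f := fun j => (lp.single 2 n (1 : ℂ) : lp (fun _ : ℕ => ℂ) 2) j *
    (((z : ℂ) - 1 / 2) / (1 / 2)) ^ j) n fun j hj => by rw [lp.single_apply_ne _ _ _ hj, zero_mul]

/-- Makes point evaluations continuous, so that norm-convergent series can be evaluated termwise. -/
theorem norm_apply_le (f : HardySpace) (z : hardyDisc) :
    ‖f z‖ ≤ (1 - ‖((z : ℂ) - 1 / 2) / (1 / 2)‖)⁻¹ * ‖f‖ := by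
  rw [← (hasSum_coeffs f z).tsum_eq]
  refine (tsum_of_norm_bounded ((hasSum_geometric_of_lt_one (norm_nonneg _)
    (norm_coord_lt_one z)).mul_left ‖f‖) fun n => ?_).trans (mul_comm _ _).le
  rw [norm_mul, norm_pow, norm_def]
  gcongr
  exact lp.norm_apply_le_norm (by norm_num) f.coeffs n

/-- Evaluation at a point of the disc. -/
noncomputable def evalCLM (z : hardyDisc) : HardySpace →L[ℂ] ℂ :=
  LinearMap.mkContinuous
    { toFun := fun f => f z
      map_add' := fun _ _ => rfl
      map_smul' := fun _ _ => rfl } _ fun f => norm_apply_le f z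

theorem evalCLM_apply (z : hardyDisc) (f : HardySpace) : evalCLM z f = f z := rfl

/-! ### Cauchy coefficients of functions holomorphic on a larger disc -/

/-- The `n`-th normalized Taylor coefficient at `1/2`, by Cauchy's formula on a circle. -/
noncomputable def cauchyCoeff (R : ℝ) (F : ℂ → ℂ) (n : ℕ) : ℂ :=
  (2 * Real.pi * Complex.I : ℂ)⁻¹ •
    ∮ z in C(1 / 2, R), ((1 / 2) / (z - 1 / 2)) ^ n • (z - 1 / 2)⁻¹ • F z

theorem norm_cauchyCoeff_le {R M : ℝ} (hR : 1 / 2 < R) {F : ℂ → ℂ}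
    (hM : ∀ z ∈ Metric.sphere (1 / 2 : ℂ) R, ‖F z‖ ≤ M) (n : ℕ) :
    ‖cauchyCoeff R F n‖ ≤ M * (1 / (2 * R)) ^ n := by
  have hR0 : 0 < R := by linarith
  refine (circleIntegral.norm_two_pi_i_inv_smul_integral_le_of_norm_le_const hR0.le
    (C := (1 / (2 * R)) ^ n * (R⁻¹ * M)) fun z hz => ?_).trans (le_of_eq ?_)
  · have hz' : ‖z - 1 / 2‖ = R := by simpa [dist_eq_norm] using hz
    rw [norm_smul, norm_smul, norm_pow, norm_div, norm_inv, hz']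
    have : ‖(1 / 2 : ℂ)‖ / R = 1 / (2 * R) := by
      rw [norm_div]; simp; field_simp
    rw [this]
    gcongr
    exact hM z hz
  · field_simp

/-- A function holomorphic on a larger closed disc restricts to an element of the Hardy space. -/
theorem exists_of_differentiableOn {R : ℝ} (hR : 1 / 2 < R) {F : ℂ → ℂ}
    (hF : DifferentiableOn ℂ F (Metric.closedBall (1 / 2) R)) {M : ℝ}
    (hM : ∀ z ∈ Metric.sphere (1 / 2 : ℂ) R, ‖F z‖ ≤ M) :
    ∃ f : HardySpace, (∀ z : hardyDisc, f z = F z) ∧ (∀ n, f.coeffs n = cauchyCoeff R F n) ∧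
      ‖f‖ ≤ M * (1 - 1 / (2 * R))⁻¹ := by
  have hR0 : 0 < R := by linarith
  have hq1 : 1 / (2 * R) < 1 := by rw [div_lt_one (by linarith)]; linarith
  have hgeom := (hasSum_geometric_of_lt_one (by positivity) hq1).mul_left M
  have hle : ∀ n, ‖cauchyCoeff R F n • monomialBasis n‖ ≤ M * (1 / (2 * R)) ^ n := fun n => by
    rw [norm_smul, monomialBasis.orthonormal.norm_eq_one, mul_one]
    exact norm_cauchyCoeff_le hR hM n
  have hs := (Summable.of_norm_bounded hgeom.summable hle).hasSum
  refine ⟨∑' n, cauchyCoeff R F n • monomialBasis n, fun z => ?_, fun n => ?_,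
    tsum_of_norm_bounded hgeom hle⟩
  · have h1 := (evalCLM z).hasSum hs
    have hz : ‖(z : ℂ) - 1 / 2‖ < R := (mem_ball_iff_norm.mp z.2).trans hR
    have hd : DiffContOnCl ℂ F (Metric.ball (1 / 2) R) := hF.diffContOnCl_ball subset_rfl
    have h2 := hasSum_cauchyPowerSeries_integral (f := F) (c := 1 / 2)
      ((hF.continuousOn.mono Metric.sphere_subset_closedBall).circleIntegrable hR0.le) hz
    rw [add_sub_cancel, hd.two_pi_i_inv_smul_circleIntegral_sub_inv_smul
      (mem_ball_iff_norm.mpr hz)] at h2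
    refine h1.unique ?_
    convert! h2 using 2 with n
    simp only [map_smul, evalCLM_apply, monomialBasis_apply,
      cauchyPowerSeries_apply, cauchyCoeff, smul_eq_mul]
    rw [mul_assoc, mul_comm _ ((_ : ℂ) ^ n), ← circleIntegral.integral_const_mul]
    congr 2
    funext x
    rw [← mul_assoc, ← mul_pow]
    congr 2
    ring
  · rw [← inner_monomialBasis]
    have h1 := (innerSL ℂ (monomialBasis n)).hasSum hs
    have h2 : HasSum (fun j => ⟪monomialBasis n, cauchyCoeff R F j • monomialBasis j⟫_ℂ)
        (cauchyCoeff R F n) := by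
      simpa [monomialBasis.orthonormal.norm_eq_one] using hasSum_single
        (f := fun j => ⟪monomialBasis n, cauchyCoeff R F j • monomialBasis j⟫_ℂ) n fun j hj => by
          rw [inner_smul_right, monomialBasis.orthonormal.2 hj.symm, mul_zero]
    exact h1.unique h2

end HardySpace

/-- Integration of a geometric series with ratio bounded away from `1` over a circle. -/
theorem circleIntegral.hasSum_geometric {c : ℂ} {R r : ℝ} (hR : 0 ≤ R) (hr0 : 0 ≤ r)
    (hr : r < 1) {F q : ℂ → ℂ} (hF : ContinuousOn F (Metric.sphere c R))
    (hq : ContinuousOn q (Metric.sphere c R)) (hqr : ∀ z ∈ Metric.sphere c R, ‖q z‖ ≤ r) :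
    HasSum (fun n : ℕ => ∮ z in C(c, R), q z ^ n • F z) (∮ z in C(c, R), (1 - q z)⁻¹ • F z) := by
  have hm : ∀ θ, circleMap c R θ ∈ Metric.sphere c R := circleMap_mem_sphere c hR
  have hFc : Continuous fun θ => F (circleMap c R θ) :=
    hF.comp_continuous (continuous_circleMap c R) hm
  have hqc : Continuous fun θ => q (circleMap c R θ) :=
    hq.comp_continuous (continuous_circleMap c R) hm
  refine intervalIntegral.hasSum_integral_of_dominated_convergence
    (fun n θ => R * ‖F (circleMap c R θ)‖ * r ^ n) (fun n => ?_) (fun n => ?_) ?_ ?_ ?_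
  · simp only [deriv_circleMap]
    exact (((continuous_circleMap 0 R).mul continuous_const).smul
      ((hqc.pow n).smul hFc)).aestronglyMeasurable
  · refine Filter.Eventually.of_forall fun θ _ => ?_
    simp only [norm_smul, norm_pow, deriv_circleMap, norm_mul, norm_circleMap_zero, abs_of_nonneg hR,
      Complex.norm_I, mul_one]
    rw [mul_assoc, mul_comm (‖F _‖)]
    gcongr
    exact hqr _ (hm θ)
  · exact Filter.Eventually.of_forall fun _ _ => (summable_geometric_of_lt_one hr0 hr).mul_left _
  · simp only [tsum_mul_left]
    exact ((continuous_const.mul hFc.norm).mul continuous_const).intervalIntegrable _ _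
  · refine Filter.Eventually.of_forall fun θ _ => HasSum.const_smul _ (HasSum.smul_const ?_ _)
    exact hasSum_geometric_of_norm_lt_one ((hqr _ (hm θ)).trans_lt hr)

/-! ### Positive matrices acting on the disc -/

namespace IsPositiveMatrix

variable {A B : Matrix (Fin 2) (Fin 2) ℝ}

theorem mul (hA : IsPositiveMatrix A) (hB : IsPositiveMatrix B) : IsPositiveMatrix (A * B) := by
  intro i j
  rw [Matrix.mul_apply, Fin.sum_univ_two]
  exact add_pos (mul_pos (hA _ _) (hB _ _)) (mul_pos (hA _ _) (hB _ _))

theorem mul_eq_of_mem_spectrum {x : ℝ} (hx : x ∈ spectrum ℝ B) :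
    (x - B 0 0) * (x - B 1 1) = B 0 1 * B 1 0 := by
  rw [spectrum.mem_iff, Matrix.isUnit_iff_isUnit_det, isUnit_iff_ne_zero, not_not,
    Matrix.det_fin_two] at hx
  simp [Matrix.algebraMap_matrix_apply] at hx
  linarith

theorem lamOne_mul_eq (hB : IsPositiveMatrix B) :
    (lamOne B - B 0 0) * (lamOne B - B 1 1) = B 0 1 * B 1 0 :=
  mul_eq_of_mem_spectrum (by rw [(spectrum_of_isPositiveMatrix hB).1]; simp)

theorem lamTwo_mul_eq (hB : IsPositiveMatrix B) :
    (lamTwo B - B 0 0) * (lamTwo B - B 1 1) = B 0 1 * B 1 0 :=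
  mul_eq_of_mem_spectrum (by rw [(spectrum_of_isPositiveMatrix hB).1]; simp)

theorem lamTwo_lt_lamOne (hB : IsPositiveMatrix B) : lamTwo B < lamOne B :=
  (le_abs_self _).trans_lt (spectrum_of_isPositiveMatrix hB).2

theorem lamOne_pos (hB : IsPositiveMatrix B) : 0 < lamOne B :=
  (abs_nonneg _).trans_lt (spectrum_of_isPositiveMatrix hB).2

theorem lamOne_add_lamTwo (hB : IsPositiveMatrix B) :
    lamOne B + lamTwo B = B 0 0 + B 1 1 := by
  have h := hB.lamTwo_lt_lamOne
  have h1 := hB.lamOne_mul_eq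
  have h2 := hB.lamTwo_mul_eq
  refine sub_eq_zero.mp ((mul_eq_zero.mp ?_).resolve_left (sub_pos.mpr h).ne')
  linear_combination h1 - h2

/-- The product of the two differences is `bc > 0`, so they have the same sign; both negative would
give `2 λ₁ < λ₁ + λ₂`. -/
theorem diag_lt_lamOne (hB : IsPositiveMatrix B) : B 0 0 < lamOne B ∧ B 1 1 < lamOne B := by
  have h := hB.lamTwo_lt_lamOne
  have h1 := hB.lamOne_mul_eq
  have h2 := hB.lamOne_add_lamTwo
  have h3 := mul_pos (hB 0 1) (hB 1 0)
  rw [← h1] at h3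
  rcases pos_and_pos_or_neg_and_neg_of_mul_pos h3 with h4 | h4 <;> constructor <;> linarith [h4.1, h4.2]

theorem mem_closedDisc_iff (z : ℂ) :
    z ∈ Metric.closedBall (1 / 2 : ℂ) (1 / 2) ↔ z.re * z.re + z.im * z.im ≤ z.re := by
  have h : ‖z - 1 / 2‖ ^ 2 = z.re * z.re + z.im * z.im - z.re + (1 / 2) ^ 2 := by
    rw [← Complex.normSq_eq_norm_sq, Complex.normSq_apply]
    simp
    ring
  rw [mem_closedBall_iff_norm, ← sq_le_sq₀ (norm_nonneg _) (by norm_num), h]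
  constructor <;> intro h' <;> linarith

theorem weight_re (B : Matrix (Fin 2) (Fin 2) ℝ) (z : ℂ) :
    (weight B z).re = (B 0 0 + B 1 0) * z.re + (B 0 1 + B 1 1) * (1 - z.re) := by
  simp [weight]
  ring

/-- `Re w_B` is a convex combination of the column sums `a + c` and `b + d`. Both exceed `λ₂`,
because `λ₂ = a + d - λ₁` is smaller than `a` and than `d`. -/
theorem lt_weight_re (hB : IsPositiveMatrix B) {z : ℂ}
    (hz : z ∈ Metric.closedBall (1 / 2 : ℂ) (1 / 2)) :
    0 < (weight B z).re ∧ lamTwo B < (weight B z).re := by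
  rw [mem_closedDisc_iff] at hz
  rw [weight_re]
  have h0 : 0 ≤ z.re := by nlinarith [mul_self_nonneg z.re, mul_self_nonneg z.im]
  have h1 : z.re ≤ 1 := by nlinarith [mul_self_nonneg z.im]
  have key : ∀ c < min (B 0 0 + B 1 0) (B 0 1 + B 1 1),
      c < (B 0 0 + B 1 0) * z.re + (B 0 1 + B 1 1) * (1 - z.re) := by
    intro c hc
    obtain ⟨hc1, hc2⟩ := lt_min_iff.mp hc
    rcases h0.eq_or_lt with h | h
    · rw [← h]; linarith
    · nlinarith
  have hs := hB.lamOne_add_lamTwo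
  have hd := hB.diag_lt_lamOne
  have := hB 0 0
  have := hB 0 1
  have := hB 1 0
  have := hB 1 1
  exact ⟨key 0 (lt_min (by linarith) (by linarith)),
    key _ (lt_min (by linarith) (by linarith))⟩

/-- `φ_B` maps the closed disc into the open disc. -/
theorem norm_projMap_sub_lt (hB : IsPositiveMatrix B) {z : ℂ}
    (hz : z ∈ Metric.closedBall (1 / 2 : ℂ) (1 / 2)) :
    ‖(B 0 0 - B 0 1) * z + B 0 1 - 1 / 2 * weight B z‖ < 1 / 2 * ‖weight B z‖ := by
  rw [mem_closedDisc_iff] at hz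
  have ha := hB 0 0
  have hb := hB 0 1
  have hc := hB 1 0
  have hd := hB 1 1
  rw [← sq_lt_sq₀ (norm_nonneg _) (by positivity), mul_pow, ← Complex.normSq_eq_norm_sq,
    ← Complex.normSq_eq_norm_sq, Complex.normSq_apply, Complex.normSq_apply]
  simp only [weight]
  generalize B 0 0 = a at *
  generalize B 0 1 = b at *
  generalize B 1 0 = c at *
  generalize B 1 1 = d at *
  obtain ⟨x, y⟩ := z
  simp only at hz
  simp
  -- The difference of the two squares is `ac|z|² + bd|1 - z|² + (ad + bc)(Re z - |z|²)`. On the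
  -- boundary the last term vanishes; strictness comes from `z` and `1 - z` not being both zero.
  have e0 : 0 < (a * c) * (x * x + y * y) + (b * d) * ((1 - x) * (1 - x) + y * y) := by
    rcases le_or_gt x (1 / 2) with h | h
    · have h1 : 0 < (1 - x) * (1 - x) + y * y := by nlinarith [mul_self_nonneg y]
      have h2 : 0 ≤ x * x + y * y := by nlinarith [mul_self_nonneg y, mul_self_nonneg x]
      positivity
    · have h1 : 0 ≤ (1 - x) * (1 - x) + y * y := by
        nlinarith [mul_self_nonneg y, mul_self_nonneg (1 - x)]
      have h2 : 0 < x * x + y * y := by nlinarith [mul_self_nonneg y]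
      positivity
  have e3 : 0 ≤ (a * d + b * c) * (x - (x * x + y * y)) := by
    have : 0 ≤ x - (x * x + y * y) := by linarith
    positivity
  nlinarith

theorem continuous_weight (B : Matrix (Fin 2) (Fin 2) ℝ) : Continuous (weight B) := by
  unfold weight
  fun_prop

theorem differentiable_weight (B : Matrix (Fin 2) (Fin 2) ℝ) : Differentiable ℂ (weight B) := by
  unfold weight
  fun_prop

theorem weight_ne_zero {z : ℂ} (h : 0 < (weight B z).re) : weight B z ≠ 0 := fun h0 => by
  simp [h0] at h

theorem projMap_sub_half {z : ℂ} (h : weight B z ≠ 0) :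
    projMap B z - 1 / 2 = ((B 0 0 - B 0 1) * z + B 0 1 - 1 / 2 * weight B z) / weight B z := by
  rw [sub_div, mul_div_cancel_right₀ _ h]
  rfl

theorem differentiableAt_projMap {z : ℂ} (h : weight B z ≠ 0) :
    DifferentiableAt ℂ (projMap B) z := by
  have : DifferentiableAt ℂ (fun z => ((B 0 0 - B 0 1 : ℂ) * z + B 0 1) / weight B z) z :=
    DifferentiableAt.div (by fun_prop) (differentiable_weight B z) h
  exact this

/-- On a slightly larger disc, `w_B` stays to the right of `0` and of `λ₂`, and `φ_B` still maps
into a smaller disc. -/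
theorem exists_radius (hB : IsPositiveMatrix B) : ∃ R r : ℝ, 1 / 2 < R ∧ 0 ≤ r ∧ r < 1 ∧
    ∀ z ∈ Metric.closedBall (1 / 2 : ℂ) R, 0 < (weight B z).re ∧ lamTwo B < (weight B z).re ∧
      ‖(projMap B z - 1 / 2) / (1 / 2)‖ ≤ r := by
  have hw := continuous_weight B
  -- The third condition is cleared of its denominator, so `U` is visibly open. It contains the
  -- compact closed disc, hence also a closed thickening of it.
  let U : Set ℂ := {z | 0 < (weight B z).re} ∩ ({z | lamTwo B < (weight B z).re} ∩
    {z | ‖(B 0 0 - B 0 1) * z + B 0 1 - 1 / 2 * weight B z‖ < 1 / 2 * ‖weight B z‖})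
  have hU : IsOpen U :=
    (isOpen_lt (by fun_prop) (by fun_prop)).inter ((isOpen_lt (by fun_prop) (by fun_prop)).inter
      (isOpen_lt (by fun_prop) (by fun_prop)))
  obtain ⟨δ, hδ, hsub⟩ := (isCompact_closedBall (1 / 2 : ℂ) (1 / 2)).exists_cthickening_subset_open
    hU fun z hz => ⟨(hB.lt_weight_re hz).1, (hB.lt_weight_re hz).2, hB.norm_projMap_sub_lt hz⟩
  rw [cthickening_closedBall hδ.le (by norm_num)] at hsub
  have hcont : ContinuousOn (fun z => ‖(projMap B z - 1 / 2) / (1 / 2)‖)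
      (Metric.closedBall (1 / 2 : ℂ) (δ + 1 / 2)) := fun z hz =>
    (((differentiableAt_projMap (weight_ne_zero (hsub hz).1)).continuousAt.sub
      continuousAt_const).div_const _).norm.continuousWithinAt
  -- The maximum over the larger disc is attained at `x` and serves as `r`.
  obtain ⟨x, hx, hmax⟩ := (isCompact_closedBall (1 / 2 : ℂ) (δ + 1 / 2)).exists_isMaxOn
    ⟨1 / 2, Metric.mem_closedBall_self (by positivity)⟩ hcont
  refine ⟨δ + 1 / 2, _, by linarith, norm_nonneg _, ?_, fun z hz =>
    ⟨(hsub hz).1, (hsub hz).2.1, hmax hz⟩⟩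
  have hx0 := weight_ne_zero (hsub hx).1
  rw [norm_div, projMap_sub_half hx0, norm_div, div_div, div_lt_one]
  · have : ‖(1 / 2 : ℂ)‖ = 1 / 2 := by simp
    rw [this, mul_comm ‖weight B x‖]
    exact (hsub hx).2.2
  · exact mul_pos (norm_pos_iff.mpr hx0) (by norm_num)

/-! ### The fixed point and the factorization of `z - φ_B(z)` -/

/-- The fixed point of `φ_B` in the disc. -/
noncomputable def fixedPoint (B : Matrix (Fin 2) (Fin 2) ℝ) : ℂ :=
  ((B 0 1 / (B 0 1 + lamOne B - B 0 0) : ℝ) : ℂ)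

theorem fixedPoint_denom_ne_zero (hB : IsPositiveMatrix B) :
    B 0 1 + lamOne B - B 0 0 ≠ 0 := by
  linarith [hB 0 1, hB.diag_lt_lamOne.1]

theorem fixedPoint_mem (hB : IsPositiveMatrix B) : fixedPoint B ∈ hardyDisc := by
  have h := hB 0 1
  have h' := hB.diag_lt_lamOne.1
  rw [mem_hardyDisc_iff, fixedPoint, Complex.normSq_ofReal, Complex.ofReal_re]
  have h1 : 0 < B 0 1 / (B 0 1 + lamOne B - B 0 0) := div_pos h (by linarith)
  have h2 : B 0 1 / (B 0 1 + lamOne B - B 0 0) < 1 := (div_lt_one (by linarith)).mpr (by linarith)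
  nlinarith

/-- `(z₀, 1 - z₀)ᵀ` is the Perron eigenvector with entry sum `1`, and the weight is the entry sum of
its image. -/
theorem weight_fixedPoint (hB : IsPositiveMatrix B) : weight B (fixedPoint B) = lamOne B := by
  have h := hB.fixedPoint_denom_ne_zero
  have h1 := hB.lamOne_mul_eq
  have : (B 0 0 + B 1 0 - B 0 1 - B 1 1) * (B 0 1 / (B 0 1 + lamOne B - B 0 0)) + B 0 1 + B 1 1
      = lamOne B := by
    field_simp
    linear_combination -h1
  rw [weight, fixedPoint]
  exact_mod_cast this

/-- The factor `w_B - λ₂` stands in for the second fixed point, so the identity also covers a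
constant weight. -/
theorem sub_projMap (hB : IsPositiveMatrix B) {z : ℂ} (hz : weight B z ≠ 0) :
    z - projMap B z = (z - fixedPoint B) * (weight B z - lamTwo B) / weight B z := by
  have h : ((B 0 1 : ℂ) + lamOne B - B 0 0) ≠ 0 := by
    exact_mod_cast hB.fixedPoint_denom_ne_zero
  have h1 : ((lamOne B : ℂ) - B 0 0) * (lamOne B - B 1 1) = B 0 1 * B 1 0 := by
    exact_mod_cast hB.lamOne_mul_eq
  have h2 : (lamOne B : ℂ) + lamTwo B = B 0 0 + B 1 1 := by
    exact_mod_cast hB.lamOne_add_lamTwo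
  have h3 : (lamTwo B : ℂ) = B 0 0 + B 1 1 - lamOne B := by linear_combination h2
  have hp : projMap B z = ((B 0 0 - B 0 1) * z + B 0 1) / weight B z := rfl
  rw [hp, eq_div_iff hz, sub_mul, div_mul_cancel₀ _ hz, fixedPoint, h3]
  push_cast
  rw [weight]
  field_simp
  linear_combination (-z) * h1

end IsPositiveMatrix

/-- Apply `A` to `B (z, 1 - z)ᵀ = w_B(z) (φ_B(z), 1 - φ_B(z))ᵀ` and compare entry sums; the first
entries give the rule for `projMap`. -/
theorem weight_mul_apply {A B : Matrix (Fin 2) (Fin 2) ℝ} {z : ℂ} (hz : weight B z ≠ 0) :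
    weight (A * B) z = weight B z * weight A (projMap B z) := by
  have hp : projMap B z * weight B z = (B 0 0 - B 0 1) * z + B 0 1 := div_mul_cancel₀ _ hz
  simp only [weight] at hp ⊢
  simp only [Matrix.mul_apply, Fin.sum_univ_two]
  push_cast
  linear_combination -(A 0 0 + A 1 0 - A 0 1 - A 1 1 : ℂ) * hp

theorem projMap_mul_apply {A B : Matrix (Fin 2) (Fin 2) ℝ} {z : ℂ} (hz : weight B z ≠ 0) :
    projMap (A * B) z = projMap A (projMap B z) := by
  have hp : ∀ (B : Matrix (Fin 2) (Fin 2) ℝ) (z : ℂ),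
    projMap B z = ((B 0 0 - B 0 1) * z + B 0 1) / weight B z := fun _ _ => rfl
  rw [hp, weight_mul_apply hz, hp A, ← div_div]
  congr 1
  rw [hp, eq_comm, eq_div_iff hz, add_mul, mul_assoc, div_mul_cancel₀ _ hz, weight]
  simp only [Matrix.mul_apply, Fin.sum_univ_two]
  push_cast
  ring

/-- Both arguments lie in `(-π/2, π/2)`, so their sum stays in the principal range and `log` is
additive. -/
theorem Complex.mul_cpow_of_re_pos {x y : ℂ} (hx : 0 < x.re) (hy : 0 < y.re) (t : ℂ) :
    (x * y) ^ t = x ^ t * y ^ t := by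
  have hx0 : x ≠ 0 := fun h => by simp [h] at hx
  have hy0 : y ≠ 0 := fun h => by simp [h] at hy
  have hxa := abs_lt.mp (Complex.abs_arg_lt_pi_div_two_iff.mpr (Or.inl hx))
  have hya := abs_lt.mp (Complex.abs_arg_lt_pi_div_two_iff.mpr (Or.inl hy))
  rw [Complex.cpow_def_of_ne_zero hx0, Complex.cpow_def_of_ne_zero hy0,
    Complex.cpow_def_of_ne_zero (mul_ne_zero hx0 hy0),
    Complex.log_mul hx0 hy0 ⟨by linarith, by linarith⟩, add_mul, Complex.exp_add]

/-! ### Weighted composition operators -/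

/-- The sum of the diagonal Cauchy coefficients of `w_B ^ t` times the powers of `φ_B` localizes at
the fixed point of `φ_B`. -/
theorem IsPositiveMatrix.hasSum_cauchyCoeff {B : Matrix (Fin 2) (Fin 2) ℝ}
    (hB : IsPositiveMatrix B) (t : ℂ) {R r : ℝ} (hR : 1 / 2 < R) (hr0 : 0 ≤ r) (hr1 : r < 1)
    (h : ∀ z ∈ Metric.closedBall (1 / 2 : ℂ) R, 0 < (weight B z).re ∧
      lamTwo B < (weight B z).re ∧ ‖(projMap B z - 1 / 2) / (1 / 2)‖ ≤ r) :
    HasSum (fun n => HardySpace.cauchyCoeff R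
        (fun z => weight B z ^ t * ((projMap B z - 1 / 2) / (1 / 2)) ^ n) n)
      ((lamOne B : ℂ) ^ t * (1 - (lamTwo B : ℂ) / (lamOne B : ℂ))⁻¹) := by
  have hR0 : 0 < R := by linarith
  have hsub : ∀ z ∈ Metric.closedBall (1 / 2 : ℂ) R, weight B z - lamTwo B ≠ 0 := fun z hz h0 => by
    have h1 := (h z hz).2.1
    rw [sub_eq_zero.mp h0, Complex.ofReal_re] at h1
    exact h1.false
  have hdw : ∀ z ∈ Metric.closedBall (1 / 2 : ℂ) R,
      DifferentiableAt ℂ (fun z => weight B z ^ t) z := fun z hz =>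
    (differentiable_weight B z).cpow_const (Or.inl (h z hz).1)
  have hne : ∀ z ∈ Metric.sphere (1 / 2 : ℂ) R, z - 1 / 2 ≠ 0 := fun z hz h0 => by
    rw [mem_sphere_iff_norm, h0, norm_zero] at hz
    exact hR0.ne hz
  -- `G(z) / (z - z₀)` is `w_B ^ t / (z - φ_B(z))` with its only pole in the disc split off.
  let G : ℂ → ℂ := fun z => weight B z ^ t * (weight B z / (weight B z - lamTwo B))
  have hG : DiffContOnCl ℂ G (Metric.ball (1 / 2) R) := by
    refine DifferentiableOn.diffContOnCl_ball (U := Metric.closedBall (1 / 2) R)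
      (fun z hz => ?_) subset_rfl
    exact ((hdw z hz).mul ((differentiable_weight B z).div
      ((differentiable_weight B z).sub_const _) (hsub z hz))).differentiableWithinAt
  have hz0 : fixedPoint B ∈ Metric.ball (1 / 2 : ℂ) R :=
    Metric.ball_subset_ball hR.le hB.fixedPoint_mem
  have hval : (2 * Real.pi * Complex.I : ℂ)⁻¹ • ∮ z in C(1 / 2, R), (z - fixedPoint B)⁻¹ • G z
      = (lamOne B : ℂ) ^ t * (1 - (lamTwo B : ℂ) / (lamOne B : ℂ))⁻¹ := by
    rw [hG.two_pi_i_inv_smul_circleIntegral_sub_inv_smul hz0]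
    have h1 : (lamOne B : ℂ) ≠ 0 := Complex.ofReal_ne_zero.mpr hB.lamOne_pos.ne'
    simp only [G, hB.weight_fixedPoint]
    rw [one_sub_div h1, inv_div]
  rw [← hval]
  -- The powers of `1/2` cancel, so the `n`-th diagonal integrand is `q ^ n * w_B ^ t / (z - 1/2)`.
  -- On the circle `|z - 1/2| = R ≥ 1/2`, whence `|q| ≤ r`.
  let q : ℂ → ℂ := fun z => (projMap B z - 1 / 2) / (z - 1 / 2)
  have hq : ∀ z ∈ Metric.sphere (1 / 2 : ℂ) R, ‖q z‖ ≤ r := fun z hz => by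
    have h1 := (h z (Metric.sphere_subset_closedBall hz)).2.2
    have h2 : ‖z - 1 / 2‖ = R := mem_sphere_iff_norm.mp hz
    refine le_trans ?_ h1
    rw [norm_div, norm_div, h2]
    gcongr
    · simp
    · rw [norm_div, norm_one, Complex.norm_two]
      exact hR.le
  have hpd : ∀ z ∈ Metric.sphere (1 / 2 : ℂ) R, DifferentiableAt ℂ (projMap B) z := fun z hz =>
    differentiableAt_projMap (weight_ne_zero (h z (Metric.sphere_subset_closedBall hz)).1)
  have hsum := circleIntegral.hasSum_geometric (c := 1 / 2) (R := R) hR0.le hr0 hr1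
    (F := fun z => (z - 1 / 2)⁻¹ • weight B z ^ t) (q := q)
    (fun z hz => (((continuousAt_id.sub continuousAt_const).inv₀ (hne z hz)).smul
      (hdw z (Metric.sphere_subset_closedBall hz)).continuousAt).continuousWithinAt)
    (fun z hz => (((hpd z hz).continuousAt.sub continuousAt_const).div
      (continuousAt_id.sub continuousAt_const) (hne z hz)).continuousWithinAt) hq
  have hI : (∮ z in C(1 / 2, R), (1 - q z)⁻¹ • (z - 1 / 2)⁻¹ • weight B z ^ t) =
      ∮ z in C(1 / 2, R), (z - fixedPoint B)⁻¹ • G z := by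
    refine circleIntegral.integral_congr hR0.le fun z hz => ?_
    have hzc := Metric.sphere_subset_closedBall hz
    have hw := weight_ne_zero (h z hzc).1
    have h1 : (1 - q z) * (z - 1 / 2) = (z - fixedPoint B) * (weight B z - lamTwo B) / weight B z := by
      rw [← hB.sub_projMap hw, sub_mul, div_mul_cancel₀ _ (hne z hz)]
      ring
    simp only [smul_eq_mul, G]
    rw [← mul_assoc, ← mul_inv, h1, inv_div, div_eq_mul_inv, mul_inv]
    ring
  rw [hI] at hsum
  convert! hsum.const_smul (2 * Real.pi * Complex.I : ℂ)⁻¹ using 2 with n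
  rw [HardySpace.cauchyCoeff]
  congr 2
  funext z
  simp only [q, smul_eq_mul, div_eq_mul_inv, inv_inv, mul_pow, inv_pow, one_mul]
  have : ((2 : ℂ) ^ n)⁻¹ * 2 ^ n = 1 := inv_mul_cancel₀ (pow_ne_zero n two_ne_zero)
  linear_combination ((z - 2⁻¹) ^ n)⁻¹ * (z - 2⁻¹)⁻¹ * weight B z ^ t *
    (projMap B z - 2⁻¹) ^ n * this

open HardySpace in
/-- The operator `f ↦ w_B ^ t * f ∘ φ_B` on the Hardy space, with its decay and its trace. -/
theorem IsPositiveMatrix.exists_weightedComp {B : Matrix (Fin 2) (Fin 2) ℝ}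
    (hB : IsPositiveMatrix B) (t : ℂ) :
    ∃ C : HardySpace →L[ℂ] HardySpace,
      (∀ (f : HardySpace) (z : hardyDisc),
        C f z = weight B z ^ t * f ⟨projMap B z, projMap_mem hB z.2⟩) ∧
      HasGeometricDecay monomialBasis C ∧
      HasTrace C ((lamOne B : ℂ) ^ t * (1 - (lamTwo B : ℂ) / (lamOne B : ℂ))⁻¹) := by
  obtain ⟨R, r, hR, hr0, hr1, h⟩ := hB.exists_radius
  have hdw : ∀ z ∈ Metric.closedBall (1 / 2 : ℂ) R,
      DifferentiableAt ℂ (fun z => weight B z ^ t) z := fun z hz =>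
    (differentiable_weight B z).cpow_const (Or.inl (h z hz).1)
  obtain ⟨M, hM⟩ := (isCompact_closedBall (1 / 2 : ℂ) R).exists_bound_of_continuousOn
    fun z hz => (hdw z hz).continuousAt.continuousWithinAt
  have hM0 : 0 ≤ M := (norm_nonneg _).trans
    (hM (1 / 2) (Metric.mem_closedBall_self (by linarith)))
  let F : ℕ → ℂ → ℂ := fun n z => weight B z ^ t * ((projMap B z - 1 / 2) / (1 / 2)) ^ n
  have hF : ∀ n, DifferentiableOn ℂ (F n) (Metric.closedBall (1 / 2) R) := fun n z hz =>
    ((hdw z hz).mul ((((differentiableAt_projMap (weight_ne_zero (h z hz).1)).sub_const _).div_const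
      _).pow n)).differentiableWithinAt
  have hFM : ∀ n, ∀ z ∈ Metric.sphere (1 / 2 : ℂ) R, ‖F n z‖ ≤ M * r ^ n := fun n z hz => by
    have hz' := Metric.sphere_subset_closedBall hz
    simp only [F, norm_mul, norm_pow]
    gcongr
    · exact hM z hz'
    · exact (h z hz').2.2
  choose g hg hgc hgn using fun n => exists_of_differentiableOn hR (hF n) (hFM n)
  have hgn' : ∀ n, ‖InnerProductSpace.rankOne ℂ (g n) (monomialBasis n)‖ ≤
      M * (1 - 1 / (2 * R))⁻¹ * r ^ n := fun n => by
    rw [InnerProductSpace.norm_rankOne, monomialBasis.orthonormal.norm_eq_one, mul_one]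
    exact (hgn n).trans_eq (by ring)
  have hsum := (Summable.of_norm_bounded
    ((summable_geometric_of_lt_one hr0 hr1).mul_left _) hgn').hasSum
  -- Building the operator from its columns `g n = w_B ^ t * eₙ ∘ φ_B`, as a norm-convergent sum of
  -- rank-one operators, makes boundedness automatic.
  set C := ∑' n, InnerProductSpace.rankOne ℂ (g n) (monomialBasis n) with hC
  have hCapp : ∀ (f : HardySpace) (z : hardyDisc),
      C f z = weight B z ^ t * f ⟨projMap B z, projMap_mem hB z.2⟩ := fun f z => by
    have h1 := ((evalCLM z).comp (ContinuousLinearMap.apply ℂ HardySpace f)).hasSum hsum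
    have h2 := (hasSum_coeffs f ⟨projMap B z, projMap_mem hB z.2⟩).mul_left (weight B z ^ t)
    refine h1.unique ?_
    convert! h2 using 2 with n
    simp only [ContinuousLinearMap.comp_apply, ContinuousLinearMap.apply_apply,
      InnerProductSpace.rankOne_apply, map_smul, evalCLM_apply, inner_monomialBasis, hg, F,
      smul_eq_mul]
    ring
  have hCe : ∀ n, C (monomialBasis n) = g n := fun n => ext_fun fun z => by
    rw [hCapp, hg, monomialBasis_apply]
  have hdecay : HasGeometricDecay monomialBasis C :=
    ⟨M * (1 - 1 / (2 * R))⁻¹, r, hr0, hr1, fun n => by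
      rw [hCe]
      exact (hgn n).trans_eq (by ring)⟩
  refine ⟨C, hCapp, hdecay, hdecay.hasTrace ?_⟩
  simp only [inner_monomialBasis, hCe, hgc]
  exact hB.hasSum_cauchyCoeff t hR hr0 hr1 h

namespace IsPositiveMatrix

variable {A B : Matrix (Fin 2) (Fin 2) ℝ}

/-- The weighted composition operator `f ↦ w_B ^ t * f ∘ φ_B`. -/
noncomputable def weightedComp (hB : IsPositiveMatrix B) (t : ℂ) : HardySpace →L[ℂ] HardySpace :=
  (hB.exists_weightedComp t).choose

theorem weightedComp_apply (hB : IsPositiveMatrix B) (t : ℂ) (f : HardySpace) (z : hardyDisc) :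
    hB.weightedComp t f z = weight B z ^ t * f ⟨projMap B z, projMap_mem hB z.2⟩ :=
  (hB.exists_weightedComp t).choose_spec.1 f z

theorem hasGeometricDecay_weightedComp (hB : IsPositiveMatrix B) (t : ℂ) :
    HasGeometricDecay HardySpace.monomialBasis (hB.weightedComp t) :=
  (hB.exists_weightedComp t).choose_spec.2.1

theorem hasTrace_weightedComp (hB : IsPositiveMatrix B) (t : ℂ) :
    HasTrace (hB.weightedComp t)
      ((lamOne B : ℂ) ^ t * (1 - (lamTwo B : ℂ) / (lamOne B : ℂ))⁻¹) :=
  (hB.exists_weightedComp t).choose_spec.2.2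

/-- Composition is contravariant, so the order of the matrices is reversed. -/
theorem weightedComp_mul_weightedComp (hA : IsPositiveMatrix A) (hB : IsPositiveMatrix B) (t : ℂ) :
    hB.weightedComp t * hA.weightedComp t = (hA.mul hB).weightedComp t := by
  refine ContinuousLinearMap.ext fun f => HardySpace.ext_fun fun z => ?_
  have hz := hB.lt_weight_re (Metric.ball_subset_closedBall z.2)
  have hz' := hA.lt_weight_re (Metric.ball_subset_closedBall (projMap_mem hB z.2))
  have hw := weight_ne_zero hz.1
  rw [mul_apply_eq_comp, weightedComp_apply, weightedComp_apply, weightedComp_apply,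
    ← mul_assoc, weight_mul_apply hw, Complex.mul_cpow_of_re_pos hz.1 hz'.1]
  have e : (⟨projMap A (projMap B z), projMap_mem hA (projMap_mem hB z.2)⟩ : hardyDisc) =
      ⟨projMap (A * B) z, projMap_mem (hA.mul hB) z.2⟩ := Subtype.ext (projMap_mul_apply hw).symm
  rw [e]

end IsPositiveMatrix

/-! ### Words and powers of the transfer operator -/

theorem wordProd_cons {k m : ℕ} (A : Fin k → Matrix (Fin 2) (Fin 2) ℝ) (a : Fin k)
    (i : Fin m → Fin k) : wordProd A (Fin.cons a i : Fin (m + 1) → Fin k) = A a * wordProd A i := by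
  simp [wordProd, List.ofFn_succ]

/-- Words must be nonempty: the empty product is the identity, whose off-diagonal entries vanish. -/
theorem isPositiveMatrix_wordProd {k : ℕ} {A : Fin k → Matrix (Fin 2) (Fin 2) ℝ}
    (hA : ∀ i, IsPositiveMatrix (A i)) :
    ∀ {m : ℕ} (i : Fin (m + 1) → Fin k), IsPositiveMatrix (wordProd A i)
  | 0, i => by simpa [wordProd] using hA (i 0)
  | m + 1, i => by
    rw [← Fin.cons_self_tail i, wordProd_cons]
    exact (hA _).mul (isPositiveMatrix_wordProd hA _)

/-- The powers of the transfer operator are sums over words. -/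
theorem sum_weightedComp_pow {k : ℕ} {A : Fin k → Matrix (Fin 2) (Fin 2) ℝ}
    (hA : ∀ i, IsPositiveMatrix (A i)) (p : Fin k → ℝ) (t : ℂ) (m : ℕ) :
    (∑ i, (p i : ℂ) • (hA i).weightedComp t) ^ (m + 1) =
      ∑ i : Fin (m + 1) → Fin k, ((∏ j, p (i j) : ℝ) : ℂ) •
        (isPositiveMatrix_wordProd hA i).weightedComp t := by
  have congrM : ∀ {B B' : Matrix (Fin 2) (Fin 2) ℝ} (hB : IsPositiveMatrix B)
      (hB' : IsPositiveMatrix B'), B = B' → hB.weightedComp t = hB'.weightedComp t := by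
    rintro B _ hB hB' rfl
    rfl
  induction m with
  | zero =>
    refine (pow_one _).trans ?_
    refine Fintype.sum_equiv (Equiv.funUnique (Fin 1) (Fin k)).symm _ _ fun i => ?_
    congr 1
    · simp
    · exact congrM _ _ (by simp [wordProd])
  | succ m ih =>
    -- The new factor stands on the right of the operator product, hence by contravariance its
    -- letter goes to the front of the word.
    rw [pow_succ, ih, Finset.sum_mul_sum, Finset.sum_comm, ← Finset.sum_product',
      Finset.univ_product_univ]
    refine Fintype.sum_equiv (Fin.consEquiv fun _ => Fin k) _ _ fun x => ?_
    rw [smul_mul_smul_comm, IsPositiveMatrix.weightedComp_mul_weightedComp]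
    congr 1
    · rw [Fin.prod_univ_succ (n := m + 1)]
      simp [Fin.consEquiv, mul_comm]
    · exact congrM _ _ (wordProd_cons A x.1 x.2).symm

theorem proposition3p3 {k : ℕ} (A : Fin k → Matrix (Fin 2) (Fin 2) ℝ)
    (hA : ∀ i, IsPositiveMatrix (A i)) (hdet : ∀ i, IsUnit (A i))
    (p : Fin k → ℝ) (hp : ∀ i, 0 ≤ p i) (hp1 : ∑ i, p i = 1) (t : ℂ) :
    ∃ L : HardySpace →L[ℂ] HardySpace,
      (∀ (f : HardySpace) (z : hardyDisc), L f z = transferFun A hA p t f z) ∧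
      ∀ m : ℕ, 1 ≤ m →
        IsTraceClass (L ^ m) ∧
        HasTrace (L ^ m)
          (∑ i : Fin m → Fin k,
            ((∏ j, p (i j) : ℝ) : ℂ) * (lamOne (wordProd A i) : ℂ) ^ t *
              (1 - (lamTwo (wordProd A i) : ℂ) / (lamOne (wordProd A i) : ℂ))⁻¹) := by
  refine ⟨∑ i, (p i : ℂ) • (hA i).weightedComp t, fun f z => ?_, fun m hm => ?_⟩
  · rw [← HardySpace.evalCLM_apply, sum_apply, map_sum]
    refine Finset.sum_congr rfl fun i _ => ?_
    rw [smul_apply, map_smul, HardySpace.evalCLM_apply,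
      IsPositiveMatrix.weightedComp_apply, smul_eq_mul, mul_assoc]
  · obtain ⟨m, rfl⟩ := Nat.exists_eq_add_of_le' hm
    rw [sum_weightedComp_pow]
    refine ⟨(HasGeometricDecay.sum _ fun i _ =>
      ((isPositiveMatrix_wordProd hA i).hasGeometricDecay_weightedComp t).smul _).isTraceClass, ?_⟩
    simp only [mul_assoc]
    exact HasTrace.sum_smul _ fun i _ => (isPositiveMatrix_wordProd hA i).hasTrace_weightedComp t
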